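/- Let $(D_n)_{n\in\omega}$ be the canonical enumeration of the finite subsets of $\omega$ ($k\in D_n$ iff the $k$-th binary digit of $n$ is $1$). A set $A\in 2^\omega$ is called recursively traceable if there is a computable function $b:\omega\to\omega$ such that for every (total) function $f:\omega\to\omega$ with $f\le_T A$ there is a computable function $g:\omega\to\omega$ with $|D_{g(n)}|\le b(n)$ and $f(n)\in D_{g(n)}$ for all $n$. A supermartingale is a function $d:2^{<\omega}\to\mathbb{R}^{\ge 0}$ with $d(\sigma 0)+d(\sigma 1)\le 2d(\sigma)$ for all $\sigma$; it is r.e. if $\{(\sigma,q)\in 2^{<\omega}\times\mathbb{Q}: q<d(\sigma)\}$ is recursively enumerable. The effective Hausdorff dimension of $A$ is $$\dim(A)=\inf\Big\{s\in\mathbb{Q}\cap[0,1]:\ \limsup_{n\to\infty}\frac{d(A\upharpoonright n)}{2^{(1-s)n}}=\infty\ \text{ for some r.e. supermartingale } d\Big\},$$ where the infimum is taken in $[0,1]$ (so it is $1$ if there is no such $s$). Lemma. Every recursively traceable set $A$ has effective Hausdorff dimension $\dim(A)=0$. -/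

import Mathlib

open Filter
open scoped Computability

namespace EffDim

/-- Cantor space; a set of natural numbers is identified with its characteristic sequence. -/
abbrev Cantor : Type := ℕ → Bool

/-- The characteristic function of `A`, as an oracle. -/
def oracle (A : Cantor) : ℕ →. ℕ := fun n => Part.some (A n).toNat

/-- The canonical enumeration of the finite sets of natural numbers:
`k ∈ canonicalFinset n` iff the `k`-th binary digit of `n` is `1`. -/
def canonicalFinset (n : ℕ) : Finset ℕ := Finset.equivBitIndices n

/-- `A` is recursively traceable: there is one computable bound `b` such that every total
function `f` that is Turing reducible to `A` has a computable trace `g` bounded by `b`. -/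
def RecursivelyTraceable (A : Cantor) : Prop :=
  ∃ b : ℕ → ℕ, Computable b ∧
    ∀ f : ℕ → ℕ, (f : ℕ →. ℕ) ≤ᵀ oracle A →
      ∃ g : ℕ → ℕ, Computable g ∧
        ∀ n, (canonicalFinset (g n)).card ≤ b n ∧ f n ∈ canonicalFinset (g n)

/-- The prefix of `A` of length `n`. -/
def initSeg (A : Cantor) (n : ℕ) : List Bool := (List.range n).map A

/-- Supermartingales on binary strings. -/
structure IsSupermartingale (d : List Bool → ℝ) : Prop where
  nonneg : ∀ σ, 0 ≤ d σ
  fair : ∀ σ, d (σ ++ [false]) + d (σ ++ [true]) ≤ 2 * d σ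

/-- `d` is r.e. (left-r.e. uniformly in the string): the set of pairs of a string `σ` and a
rational `q < d σ` is recursively enumerable. Since `d` will be nonnegative, only the
nonnegative rationals `q = a / (b + 1)` matter. -/
def IsRE (d : List Bool → ℝ) : Prop :=
  REPred fun p : List Bool × ℕ × ℕ => (p.2.1 : ℝ) / ((p.2.2 : ℝ) + 1) < d p.1

/-- The `h`-success set of `d`; the limit superior is taken in the extended reals. -/
def successSet (h : ℕ → ℝ) (d : List Bool → ℝ) : Set Cantor :=
  {X | limsup (fun n : ℕ => ((d (initSeg X n) / h n : ℝ) : EReal)) atTop = ⊤}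

/-- The rationals `s` in `[0, 1]` such that one r.e. supermartingale `s`-succeeds on all
elements of `R`. -/
def successExponents (R : Set Cantor) : Set ℚ :=
  {s | 0 ≤ s ∧ s ≤ 1 ∧ ∃ d : List Bool → ℝ, IsSupermartingale d ∧ IsRE d ∧
    R ⊆ successSet (fun n => (2 : ℝ) ^ ((1 - (s : ℝ)) * (n : ℝ))) d}

/-- The effective Hausdorff dimension of a class: the infimum of the success exponents.
The infimum is taken in the interval `[0, 1]`, so it is `1` when there are none (the class of
all sequences, for instance); this is what adjoining the element `1` does. -/
noncomputable def effDim (R : Set Cantor) : ℝ :=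
  sInf (insert 1 ((fun s : ℚ => (s : ℝ)) '' successExponents R))

/-- The effective Hausdorff dimension of a single set. -/
noncomputable def effDimOf (A : Cantor) : ℝ := effDim {A}

end EffDim

/-! Since the bound `b` does not depend on the function traced, the lengths `m n = n * w`, with `w =
weight b (n + 1)`, can be fixed in advance. Tracing the codes of the prefixes of `A` of length `m n`
leaves at most `b n` candidates for each `n`. Start with capital `1 / w` for each candidate and bet
it all along that string. The weights make the total capital finite (`summable_traceTerm`), and the
sum is an r.e. supermartingale. On the prefix of length `m n` it is at least `2 ^ m n / w`
(`le_traceMartingale`). Dividing by `2 ^ ((1 - s) * m n)` leaves `2 ^ (s * n * w) / w`, which is at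
least `w` once `s * n ≥ 2`. Hence one supermartingale succeeds for every `s > 0`. -/

namespace EffDim

/-! ### Reducing a sequence of initial segments to the oracle -/

/-- The binary string with code `k`, the empty string if there is none. -/
def decodeString (k : ℕ) : List Bool := (Encodable.decode (α := List Bool) k).getD []

lemma decodeString_encode (σ : List Bool) : decodeString (Encodable.encode σ) = σ := by
  simp [decodeString]

lemma primrec_decodeString : Primrec decodeString :=
  Primrec.option_getD.comp Primrec.decode (Primrec.const [])

lemma initSeg_succ (A : Cantor) (n : ℕ) : initSeg A (n + 1) = initSeg A n ++ [A n] := by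
  simp [initSeg, List.range_succ]

lemma length_initSeg (A : Cantor) (n : ℕ) : (initSeg A n).length = n := by
  simp [initSeg]

/-- The codes of the initial segments of `A`, along a computable sequence of lengths, are Turing
reducible to `A`. -/
theorem encode_initSeg_turingReducible (A : Cantor) {m : ℕ → ℕ} (hm : Computable m) :
    ((fun n => Encodable.encode (initSeg A (m n)) : ℕ → ℕ) : ℕ →. ℕ) ≤ᵀ oracle A := by
  rw [TuringReducible, RecursiveIn.iff_nat]
  have nat {f : ℕ → ℕ} (hf : Computable f) : Nat.RecursiveIn {oracle A} (f : ℕ →. ℕ) :=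
    Nat.Partrec.recursiveIn (Partrec.nat_iff.1 hf)
  let step : ℕ → ℕ := fun p =>
    Encodable.encode (decodeString p.unpair.2 ++ [decide (p.unpair.1 = 1)])
  have hstep : Computable step := by
    refine (Primrec.encode.comp (Primrec.list_concat.comp
      (primrec_decodeString.comp (Primrec.snd.comp Primrec.unpair)) ?_)).to_comp
    exact (Primrec.eq.comp (Primrec.fst.comp Primrec.unpair) (Primrec.const 1)).decide
  -- The recursion passes `(a, (i, previous value))` to its step; the parameter `a` is a dummy, set
  -- to `0` in `hlen`.
  have hpos : Computable fun p : ℕ => p.unpair.2.unpair.1 :=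
    (Primrec.fst.comp (Primrec.unpair.comp (Primrec.snd.comp Primrec.unpair))).to_comp
  have hval : Computable fun p : ℕ => p.unpair.2.unpair.2 :=
    (Primrec.snd.comp (Primrec.unpair.comp (Primrec.snd.comp Primrec.unpair))).to_comp
  let next : ℕ → ℕ := fun p =>
    Encodable.encode (decodeString p.unpair.2.unpair.2 ++ [A p.unpair.2.unpair.1])
  have hnext : Nat.RecursiveIn {oracle A} (next : ℕ →. ℕ) := by
    have hA : Nat.RecursiveIn {oracle A}
        ((fun p => (A p.unpair.2.unpair.1).toNat : ℕ → ℕ) : ℕ →. ℕ) :=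
      ((Nat.RecursiveIn.oracle (oracle A) (Set.mem_singleton _)).comp (nat hpos)).of_eq
        fun p => Part.bind_some _ _
    have hpair : Nat.RecursiveIn {oracle A} ((fun p =>
        Nat.pair (A p.unpair.2.unpair.1).toNat p.unpair.2.unpair.2 : ℕ → ℕ) : ℕ →. ℕ) :=
      (hA.pair (nat hval)).of_eq fun p => by simp [Seq.seq]
    refine ((nat hstep).comp hpair).of_eq fun p => (Part.bind_some _ _).trans ?_
    have hbit (i : ℕ) : decide ((A i).toNat = 1) = A i := by cases A i <;> rfl
    simp only [PFun.coe_val, step, next, Nat.unpair_pair, hbit]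
  have hprec := (nat (Computable.const (Encodable.encode ([] : List Bool)))).prec hnext
  have hlen : Computable fun n => Nat.pair 0 (m n) :=
    Primrec₂.natPair.to_comp.comp (Computable.const 0) hm
  refine (hprec.comp (nat hlen)).of_eq fun n => ?_
  simp only [PFun.coe_val, Part.bind_eq_bind, Part.bind_some, Nat.unpair_pair]
  induction m n with
  | zero => simp [initSeg]
  | succ k ih =>
    dsimp only
    rw [ih]
    simp [next, decodeString_encode, initSeg_succ]

/-! ### Counting the traced extensions of a string -/

lemma mem_canonicalFinset {k e : ℕ} : k ∈ canonicalFinset e ↔ e.testBit k := by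
  simp [canonicalFinset]

lemma lt_of_mem_canonicalFinset {k e : ℕ} (h : k ∈ canonicalFinset e) : k < e :=
  Nat.lt_two_pow_self.trans_le (Nat.ge_two_pow_of_testBit (mem_canonicalFinset.1 h))

/-- The number of codes of extensions of `σ` in the finite set with canonical index `e`. -/
def traceCount (σ : List Bool) (e : ℕ) : ℕ :=
  ((canonicalFinset e).filter fun k => σ <+: decodeString k).card

/-- Elements of the set with index `e` are below `e`, so a bounded search counts them; this gives
primitive recursiveness. -/
lemma traceCount_eq_length (σ : List Bool) (e : ℕ) :
    traceCount σ e = ((List.range e).filter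
      fun k => e.testBit k ∧ σ <+: decodeString k).length := by
  rw [traceCount, ← List.toFinset_card_of_nodup (List.nodup_range.filter _)]
  congr 1
  ext k
  simp only [Finset.mem_filter, List.mem_toFinset, List.mem_filter, List.mem_range,
    decide_eq_true_eq, ← mem_canonicalFinset]
  exact ⟨fun h => ⟨lt_of_mem_canonicalFinset h.1, h⟩, fun h => h.2⟩

lemma primrec₂_nat_pow : Primrec₂ ((· ^ ·) : ℕ → ℕ → ℕ) :=
  Primrec₂.unpaired'.1 Nat.Primrec.pow

lemma primrec₂_traceCount : Primrec₂ traceCount := by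
  have hR : PrimrecRel fun (k : ℕ) (p : List Bool × ℕ) =>
      p.2 / 2 ^ k % 2 = 1 ∧ p.1 = (decodeString k).take p.1.length := by
    refine PrimrecPred.and ?_ ?_
    · refine Primrec.eq.comp (Primrec.nat_mod.comp (Primrec.nat_div.comp
        (Primrec.snd.comp Primrec.snd)
        (primrec₂_nat_pow.comp (Primrec.const 2) Primrec.fst)) (Primrec.const 2)) (Primrec.const 1)
    · exact Primrec.eq.comp (Primrec.fst.comp Primrec.snd)
        (Primrec.list_take.comp (Primrec.list_length.comp (Primrec.fst.comp Primrec.snd))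
          (primrec_decodeString.comp Primrec.fst))
  refine (Primrec.list_length.comp (hR.listFilter.comp
    (Primrec.list_range.comp Primrec.snd) Primrec.id)).of_eq fun p => ?_
  rw [traceCount_eq_length]
  congr 2
  funext k
  simp only [id, Nat.testBit_eq_decide_div_mod_eq, decide_eq_true_eq, List.prefix_iff_eq_take]

lemma traceCount_le (σ : List Bool) (e : ℕ) : traceCount σ e ≤ (canonicalFinset e).card :=
  Finset.card_filter_le _ _

/-- No string extends both children. The inequality can be strict, since a code of `σ` itself counts
only at `σ`. -/
lemma traceCount_children_le (σ : List Bool) (e : ℕ) :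
    traceCount (σ ++ [false]) e + traceCount (σ ++ [true]) e ≤ traceCount σ e := by
  unfold traceCount
  rw [← Finset.card_union_of_disjoint]
  · refine Finset.card_le_card fun k hk => ?_
    simp only [Finset.mem_union, Finset.mem_filter] at hk ⊢
    rcases hk with hk | hk <;> exact ⟨hk.1, (List.prefix_append _ _).trans hk.2⟩
  · refine Finset.disjoint_filter.2 fun k _ h₁ h₂ => ?_
    have := List.prefix_of_prefix_length_le h₁ h₂ (by simp)
    simp at this

lemma one_le_traceCount {σ : List Bool} {e : ℕ} (h : Encodable.encode σ ∈ canonicalFinset e) :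
    1 ≤ traceCount σ e :=
  Finset.card_pos.2 ⟨_, Finset.mem_filter.2 ⟨h, by rw [decodeString_encode]⟩⟩

/-! ### The supermartingale of a trace -/

/-- The weights `∏ i < n, 2 (b i + 1)`. -/
def weight (b : ℕ → ℕ) : ℕ → ℕ
  | 0 => 1
  | n + 1 => weight b n * (2 * (b n + 1))

lemma two_pow_le_weight (b : ℕ → ℕ) (n : ℕ) : 2 ^ n ≤ weight b n := by
  induction n with
  | zero => simp [weight]
  | succ n ih =>
    rw [pow_succ, weight]
    exact Nat.mul_le_mul ih (by omega)

lemma weight_pos (b : ℕ → ℕ) (n : ℕ) : 0 < weight b n :=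
  (Nat.two_pow_pos n).trans_le (two_pow_le_weight b n)

lemma computable_weight {b : ℕ → ℕ} (hb : Computable b) : Computable (weight b) := by
  have hstep : Computable₂ fun (_ : ℕ) (p : ℕ × ℕ) => p.2 * (2 * (b p.1 + 1)) :=
    Primrec.nat_mul.to_comp.comp (Computable.snd.comp Computable.snd)
      (Primrec.nat_mul.to_comp.comp (Computable.const 2)
        (Primrec.succ.to_comp.comp (hb.comp (Computable.fst.comp Computable.snd))))
  refine (Computable.nat_rec Computable.id (Computable.const 1) hstep).of_eq fun n => ?_
  simp only [id]
  induction n with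
  | zero => rfl
  | succ n ih => simp only [weight, ih]

/-- The capital on `σ` of the bets placed on the strings of the `n`-th trace component. -/
noncomputable def traceTerm (b g : ℕ → ℕ) (σ : List Bool) (n : ℕ) : ℝ :=
  (2 ^ σ.length * traceCount σ (g n) : ℕ) / (weight b (n + 1) : ℝ)

/-- The supermartingale betting on all strings of a trace `g` bounded by `b`. -/
noncomputable def traceMartingale (b g : ℕ → ℕ) (σ : List Bool) : ℝ := ∑' n, traceTerm b g σ n

lemma traceTerm_nonneg (b g : ℕ → ℕ) (σ : List Bool) (n : ℕ) : 0 ≤ traceTerm b g σ n := by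
  unfold traceTerm
  positivity

/-- In `weight b (n + 1)`, the factor `2 * (b n + 1)` absorbs the count and `weight b n ≥ 2 ^ n`
gives geometric decay. -/
lemma summable_traceTerm {b g : ℕ → ℕ} (hg : ∀ n, (canonicalFinset (g n)).card ≤ b n)
    (σ : List Bool) : Summable (traceTerm b g σ) := by
  refine Summable.of_nonneg_of_le (traceTerm_nonneg b g σ) (fun n => ?_)
    (summable_geometric_two.mul_left ((2 : ℝ) ^ σ.length))
  have hw : (0 : ℝ) < weight b (n + 1) := by exact_mod_cast weight_pos b (n + 1)
  have h : traceCount σ (g n) * 2 ^ n ≤ weight b (n + 1) := by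
    rw [weight, mul_comm]
    exact Nat.mul_le_mul (two_pow_le_weight b n)
      (((traceCount_le σ _).trans (hg n)).trans (by omega))
  have h' : (traceCount σ (g n) : ℝ) * 2 ^ n ≤ weight b (n + 1) := by exact_mod_cast h
  rw [traceTerm, div_le_iff₀ hw, one_div, inv_pow]
  push_cast
  rw [mul_assoc]
  gcongr
  rwa [← div_eq_inv_mul, le_div_iff₀ (by positivity)]

theorem isSupermartingale_traceMartingale {b g : ℕ → ℕ}
    (hg : ∀ n, (canonicalFinset (g n)).card ≤ b n) :
    IsSupermartingale (traceMartingale b g) where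
  nonneg σ := tsum_nonneg (traceTerm_nonneg b g σ)
  fair σ := by
    unfold traceMartingale
    rw [← (summable_traceTerm hg _).tsum_add (summable_traceTerm hg _), ← tsum_mul_left]
    refine ((summable_traceTerm hg _).add (summable_traceTerm hg _)).tsum_le_tsum (fun n => ?_)
      ((summable_traceTerm hg _).mul_left 2)
    unfold traceTerm
    rw [← add_div, ← mul_div_assoc]
    gcongr
    have := Nat.mul_le_mul_left (2 ^ (σ.length + 1)) (traceCount_children_le σ (g n))
    simp only [List.length_append, List.length_singleton]
    exact_mod_cast (by rw [← mul_add, ← mul_assoc, ← pow_succ']; exact this)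

/-- The numerators of the partial sums of `traceTerm` over the denominators `weight`. -/
def traceNumerator (b g : ℕ → ℕ) (σ : List Bool) : ℕ → ℕ
  | 0 => 0
  | n + 1 => traceNumerator b g σ n * (2 * (b n + 1)) + 2 ^ σ.length * traceCount σ (g n)

lemma sum_traceTerm (b g : ℕ → ℕ) (σ : List Bool) (n : ℕ) :
    ∑ i ∈ Finset.range n, traceTerm b g σ i = traceNumerator b g σ n / weight b n := by
  induction n with
  | zero => simp [traceNumerator]
  | succ n ih =>
    have hw : (weight b n : ℝ) ≠ 0 := by exact_mod_cast (weight_pos b n).ne'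
    have hb : (2 * ((b n : ℝ) + 1)) ≠ 0 := by positivity
    rw [Finset.sum_range_succ, ih, traceTerm, traceNumerator, weight]
    push_cast
    rw [add_div, mul_div_mul_right _ _ hb]

lemma computable₂_traceNumerator {b g : ℕ → ℕ} (hb : Computable b) (hg : Computable g) :
    Computable₂ (traceNumerator b g) := by
  have hn : Computable fun p : (List Bool × ℕ) × ℕ × ℕ => p.2.1 :=
    Computable.fst.comp Computable.snd
  have hσ : Computable fun p : (List Bool × ℕ) × ℕ × ℕ => p.1.1 :=
    Computable.fst.comp Computable.fst
  have hstep : Computable₂ fun (q : List Bool × ℕ) (p : ℕ × ℕ) =>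
      p.2 * (2 * (b p.1 + 1)) + 2 ^ q.1.length * traceCount q.1 (g p.1) :=
    Primrec.nat_add.to_comp.comp
      (Primrec.nat_mul.to_comp.comp (Computable.snd.comp Computable.snd)
        (Primrec.nat_mul.to_comp.comp (Computable.const 2)
          (Primrec.succ.to_comp.comp (hb.comp hn))))
      (Primrec.nat_mul.to_comp.comp
        (primrec₂_nat_pow.to_comp.comp (Computable.const 2)
          (Primrec.list_length.to_comp.comp hσ))
        (primrec₂_traceCount.to_comp.comp hσ (hg.comp hn)))
  refine (Computable.nat_rec Computable.snd (Computable.const 0) hstep).of_eq fun p => ?_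
  obtain ⟨σ, n⟩ := p
  dsimp only
  induction n with
  | zero => rfl
  | succ n ih => simp only [traceNumerator, ih]

/-- The projection of a computable relation is recursively enumerable. -/
lemma rePred_exists {α : Type*} [Primcodable α] {p : α → ℕ → Prop} [DecidableRel p]
    (hp : Computable₂ fun a n => decide (p a n)) : REPred fun a => ∃ n, p a n := by
  refine (Partrec.rfind hp.partrec₂).dom_re.of_eq fun a => ?_
  simp

theorem isRE_traceMartingale {b g : ℕ → ℕ} (hb : Computable b) (hgc : Computable g)
    (hg : ∀ n, (canonicalFinset (g n)).card ≤ b n) : IsRE (traceMartingale b g) := by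
  have hN : Computable₂ fun (p : List Bool × ℕ × ℕ) (n : ℕ) =>
      decide (p.2.1 * weight b n < traceNumerator b g p.1 n * (p.2.2 + 1)) := by
    have hp : Computable (Prod.fst : (List Bool × ℕ × ℕ) × ℕ → _) := Computable.fst
    refine Primrec.nat_lt.decide.to_comp.comp
      (Primrec.nat_mul.to_comp.comp (Computable.fst.comp (Computable.snd.comp hp))
        ((computable_weight hb).comp Computable.snd))
      (Primrec.nat_mul.to_comp.comp
        ((computable₂_traceNumerator hb hgc).comp (Computable.fst.comp hp) Computable.snd)
        (Primrec.succ.to_comp.comp (Computable.snd.comp (Computable.snd.comp hp))))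
  refine (rePred_exists hN).of_eq fun ⟨σ, k, l⟩ => ?_
  -- A rational lies below the sum iff it lies below some partial sum, and this is a decidable
  -- comparison of naturals after clearing denominators.
  have key (n : ℕ) : k * weight b n < traceNumerator b g σ n * (l + 1) ↔
      (k : ℝ) / ((l : ℝ) + 1) < ∑ i ∈ Finset.range n, traceTerm b g σ i := by
    have hw : (0 : ℝ) < weight b n := by exact_mod_cast weight_pos b n
    rw [sum_traceTerm, div_lt_div_iff₀ (by positivity) hw]
    exact_mod_cast Iff.rfl
  simp only [key]
  have hs := summable_traceTerm hg σ
  constructor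
  · rintro ⟨n, hn⟩
    exact hn.trans_le (hs.sum_le_tsum _ fun i _ => traceTerm_nonneg b g σ i)
  · intro h
    exact (hs.hasSum.tendsto_sum_nat.eventually_const_lt h).exists

/-! ### Success on the traced sequence -/

lemma le_traceMartingale {b g : ℕ → ℕ} (hg : ∀ n, (canonicalFinset (g n)).card ≤ b n)
    {σ : List Bool} {n : ℕ} (hσ : Encodable.encode σ ∈ canonicalFinset (g n)) :
    2 ^ σ.length / (weight b (n + 1) : ℝ) ≤ traceMartingale b g σ := by
  refine le_trans ?_ ((summable_traceTerm hg σ).le_tsum n fun i _ => traceTerm_nonneg b g σ i)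
  unfold traceTerm
  gcongr
  exact_mod_cast Nat.le_mul_of_pos_right _ (one_le_traceCount hσ)

lemma le_two_rpow_div_self {w : ℕ} (hw : 0 < w) {x : ℝ} (hx : 2 * (w : ℝ) ≤ x) :
    (w : ℝ) ≤ 2 ^ x / w := by
  have hw' : (0 : ℝ) < w := by exact_mod_cast hw
  have h : (w : ℝ) ≤ 2 ^ w := by exact_mod_cast Nat.lt_two_pow_self.le
  rw [le_div_iff₀ hw']
  calc (w : ℝ) * w ≤ 2 ^ w * 2 ^ w := by gcongr
    _ = 2 ^ (2 * (w : ℝ)) := by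
      rw [two_mul, Real.rpow_add two_pos, Real.rpow_natCast]
    _ ≤ 2 ^ x := Real.rpow_le_rpow_of_exponent_le one_le_two hx

/-- The supermartingale of a trace of the initial segments of lengths `n * weight b (n + 1)`
succeeds at every positive exponent. -/
theorem mem_successSet_traceMartingale {A : Cantor} {b g : ℕ → ℕ}
    (hg : ∀ n, (canonicalFinset (g n)).card ≤ b n)
    (hA : ∀ n, Encodable.encode (initSeg A (n * weight b (n + 1))) ∈ canonicalFinset (g n))
    {s : ℝ} (hs : 0 < s) :
    A ∈ successSet (fun n => (2 : ℝ) ^ ((1 - s) * (n : ℝ))) (traceMartingale b g) := by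
  refine EReal.eq_top_iff_forall_lt _ |>.2 fun y => ?_
  -- The slack `y + 1` turns a non-strict frequent bound into a strict bound on the limsup.
  refine lt_of_lt_of_le (EReal.coe_lt_coe_iff.2 (lt_add_one y)) ?_
  refine le_limsup_of_frequently_le' (frequently_atTop.2 fun N => ?_)
  obtain ⟨c, hc⟩ := exists_nat_ge (max (2 / s) (y + 1))
  let n := max N c
  let w := weight b (n + 1)
  have hw : 0 < w := weight_pos b (n + 1)
  have hnw : n ≤ w :=
    (Nat.lt_two_pow_self.le.trans (Nat.pow_le_pow_right two_pos n.le_succ)).trans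
      (two_pow_le_weight b (n + 1))
  have hcn : (c : ℝ) ≤ n := by exact_mod_cast le_max_right N c
  have hsn : 2 ≤ (n : ℝ) * s :=
    (div_le_iff₀ hs).1 (((le_max_left _ _).trans hc).trans hcn)
  have hyw : y + 1 ≤ w :=
    (((le_max_right _ _).trans hc).trans hcn).trans (by exact_mod_cast hnw)
  refine ⟨n * w, (le_max_left N c).trans (Nat.le_mul_of_pos_right n hw),
    EReal.coe_le_coe_iff.2 (hyw.trans ?_)⟩
  have hd := le_traceMartingale hg (hA n)
  rw [length_initSeg] at hd
  have hx : 2 * (w : ℝ) ≤ s * ((n * w : ℕ) : ℝ) := by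
    push_cast
    calc 2 * (w : ℝ) ≤ (n * s) * w := by gcongr
      _ = s * (n * w) := by ring
  refine (le_two_rpow_div_self hw hx).trans ?_
  rw [le_div_iff₀ (by positivity)]
  refine le_trans (le_of_eq ?_) hd
  rw [div_mul_eq_mul_div, ← Real.rpow_add two_pos, ← Real.rpow_natCast 2 (n * w)]
  congr 2
  ring

theorem RecursivelyTraceable.exists_supermartingale {A : Cantor} (hA : RecursivelyTraceable A) :
    ∃ d : List Bool → ℝ, IsSupermartingale d ∧ IsRE d ∧
      ∀ s : ℝ, 0 < s → A ∈ successSet (fun n => (2 : ℝ) ^ ((1 - s) * (n : ℝ))) d := by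
  obtain ⟨b, hb, htrace⟩ := hA
  have hm : Computable fun n => n * weight b (n + 1) :=
    Primrec.nat_mul.to_comp.comp Computable.id ((computable_weight hb).comp Computable.succ)
  obtain ⟨g, hgc, hg⟩ := htrace _ (encode_initSeg_turingReducible A hm)
  exact ⟨traceMartingale b g, isSupermartingale_traceMartingale fun n => (hg n).1,
    isRE_traceMartingale hb hgc fun n => (hg n).1,
    fun s hs => mem_successSet_traceMartingale (fun n => (hg n).1) (fun n => (hg n).2) hs⟩

end EffDim

theorem mainTheorem9 (A : EffDim.Cantor) (hA : EffDim.RecursivelyTraceable A) :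
    EffDim.effDimOf A = 0 := by
  obtain ⟨d, hd, hre, hsucc⟩ := hA.exists_supermartingale
  have hnonneg : ∀ x ∈ insert (1 : ℝ)
      ((fun s : ℚ => (s : ℝ)) '' EffDim.successExponents {A}), 0 ≤ x := by
    rintro x (rfl | ⟨s, hs, rfl⟩)
    · exact zero_le_one
    · exact Rat.cast_nonneg.2 hs.1
  refine le_antisymm (le_of_forall_gt_imp_ge_of_dense fun ε hε => ?_) (Real.sInf_nonneg hnonneg)
  -- The minimum with `1` keeps `s` an admissible exponent.
  obtain ⟨s, hs0, hs⟩ := exists_rat_btwn (lt_min hε zero_lt_one)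
  have hmem : s ∈ EffDim.successExponents {A} :=
    ⟨by exact_mod_cast hs0.le, by exact_mod_cast (hs.trans_le (min_le_right _ _)).le, d, hd, hre,
      Set.singleton_subset_iff.2 (hsucc s hs0)⟩
  exact (csInf_le ⟨0, hnonneg⟩ (Set.mem_insert_of_mem _ ⟨s, hmem, rfl⟩)).trans
    (hs.trans_le (min_le_left _ _)).le
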